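/- **Induction heads.** For a word $w=w_1\cdots w_N$ over a finite alphabet $\Sigma$ and a position $i$, let $\sigma(w,i)=\max(\{0\}\cup\{2\le j\le i : w_{j-1}=w_i\})$, let $\sigma(w,0)=0$, let $\sigma^k(w,\cdot)$ be the $k$-fold composition, and let $w_0=\bot$. **Transformers.** A transformer with $L$ layers, $H$ heads per layer, embedding dimension $m$ and token dimension $d\ge 2$ is given by arbitrary maps $Q_{t,h},K_{t,h},V_{t,h}:\mathbb R^d\to\mathbb R^m$ and matrices $W_{t,h}\in\mathbb R^{m\times d}$ ($t\le L$, $h\le H$), and an output map $\psi:\mathbb R^d\to\mathbb R^d$. Layer $t$ maps $X\in\mathbb R^{N\times d}$ to the matrix whose $i$-th row is $\sum_h\big(\sum_j a^{t,h}_{i,j}\,V_{t,h}(X_j)\big)W_{t,h}$, where $a^{t,h}$ are the attention weights; $\psi$ is applied to each row after the last layer. The transformer has *precision* $S\in\mathbb N$ if all values of $Q_{t,h},K_{t,h},V_{t,h},\psi$ and all entries of $W_{t,h}$ are integer multiples of $1/S$ in $[-S,S]$; the output of each layer is then rounded to the nearest such numbers (saturating at $\pm S$). **ANNA weights.** An ANNA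 mechanism with parameters $r,c,\ell,\eta$ for $Q,K$ produces, from $X$ and a random seed, weights $a_{i,j}\ge0$ with $\sum_j a_{i,j}=1$ such that, for each $X$, with probability at least $1-\eta$ the following holds for all $i$. Write $q_i=Q(X_i)$, $k_j=K(X_j)$ and $\mathcal N(q,t)=\{j:\|q-k_j\|_2\le t\}$. (i) If $\mathcal N(q_i,cr)\ne\emptyset$, then $a_{i,j}>0$ implies $j\in\mathcal N(q_i,cr)$. (ii) If $j\in\mathcal N(q_i,r)$, then $a_{i,j}\ge 1/((|\mathcal N(q_i,cr)|-1)\ell+1)$. **Encoding.** Identify $\Sigma$ with $\{1,\dots,|\Sigma|\}$ by any bijection, and $\bot$ with $0$. The input for $w$ is the matrix with rows $X_i=(w_i,i,0,\dots,0)\in\mathbb R^d$. **Theorem.** Let $0<\varepsilon<\varepsilon'<1$ and $C_0\in\mathbb R$. There is a constant $C>0$ depending only on $\varepsilon,\varepsilon',C_0$, and for every $a\in\mathbb N$ a constant $\zeta\in\mathbb N$ depending only on $\varepsilon,\varepsilon',C_0,a$, such that for all integers $N\ge1$, $k\ge0$ and every alphabet $\Sigma$ with $|\Sigma|\le C_0N$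 there is a transformer of precision $(N+1)^\zeta$ (so numbers have $O(\log (N+1))$ bits) with $$L\le C\log(k+2),\qquad H\le C N^{(\varepsilon'-\varepsilon)/4},\qquad m\le CN^{\varepsilon'},\qquad d\le CN^{\varepsilon'}$$ that solves the $k$-hop task with ANNA attention, in the following sense. For every $c\ge1$ there is $r>0$ such that, for all $\ell\in[1,(N+1)^a]$ and $\eta\ge0$, whatever ANNA mechanisms with parameters $r,c,\ell,\eta$ compute the weights of the heads (with independent, identically distributed seeds in the $L$ layers; heads of the same layer may share randomness), for every $w\in\Sigma^N$, with probability at least $1-LH\eta$, the $i$-th output row is $(w_{\sigma^k(w,i)},0,\dots,0)$ for all $i=1,\dots,N$. In particular, with deterministic mechanisms and $\eta=0$ the output always equals $w_{\sigma^k(w,i)}$ for every $i$ and $w$. -/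

import Mathlib

open MeasureTheory

noncomputable section

/-! ### The task: `k`-hop induction heads -/

/-- The `j`-th letter of the word `w = w₁ … w_N`, for a 1-based position `j`.
It is `none` (the symbol `⊥`) when `j` is not a position, in particular for `j = 0`. -/
def letterAt {α : Type*} {N : ℕ} (w : Fin N → α) (j : ℕ) : Option α :=
  if h : 1 ≤ j ∧ j ≤ N then some (w ⟨j - 1, by omega⟩) else none

/-- `σ(w, i) = max ({0} ∪ {j ≤ i : w_{j-1} = w_i})`, with 1-based positions. The condition
`w_{j-1} = w_i` presupposes that `i` and `j - 1` are positions; in particular `σ(w, 0) = 0`. -/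
def inductionHop {α : Type*} [DecidableEq α] {N : ℕ} (w : Fin N → α) (i : ℕ) : ℕ :=
  ((Finset.range (i + 1)).filter
    (fun j => letterAt w i ≠ none ∧ letterAt w (j - 1) = letterAt w i)).sup id

/-- `w_{σ^k(w, i)}`, which is `⊥` when `σ^k(w, i) = 0`. -/
def kHop {α : Type*} [DecidableEq α] {N : ℕ} (w : Fin N → α) (k i : ℕ) : Option α :=
  letterAt w ((inductionHop w)^[k] i)

/-! ### Fixed-point numbers -/

/-- The fixed-point numbers of scale `S`: integer multiples of `1/S` in `[-S, S]`.
Such a number takes `O(log S)` bits. -/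
def IsFixedPoint (S : ℕ) (x : ℝ) : Prop :=
  (∃ n : ℤ, x = n / S) ∧ |x| ≤ S

/-- Rounding to the nearest fixed-point number of scale `S` (with saturation). -/
def quantize (S : ℕ) (x : ℝ) : ℝ :=
  max (-(S : ℝ)) (min (S : ℝ) ((round (x * S) : ℝ) / S))

/-! ### Approximate nearest neighbor attention -/

/-- The number of keys in `𝒩(q, t)`, counted with multiplicity (that is, by index). -/
def nearCount {N m : ℕ} (k : Fin N → EuclideanSpace ℝ (Fin m)) (q : EuclideanSpace ℝ (Fin m))
    (t : ℝ) : ℕ :=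
  Nat.card {j : Fin N // ‖q - k j‖ ≤ t}

/-- The two conditions of approximate nearest neighbor attention on the attention weights `w`,
for queries `q`, keys `k` and parameters `r, c, ℓ`.
* A key of positive weight lies within `c * r` of the query. (If no key does, then no weights of
  sum one can satisfy this, and nothing is asked.)
* A key within `r` of the query has weight at least `1 / ((|𝒩(q, c r)| - 1) ℓ + 1)`. -/
def GoodWeights {N m : ℕ} (r c ell : ℝ) (q k : Fin N → EuclideanSpace ℝ (Fin m))
    (w : Fin N → Fin N → ℝ) : Prop :=
  ∀ i, ((∃ j, ‖q i - k j‖ ≤ c * r) → ∀ j, 0 < w i j → ‖q i - k j‖ ≤ c * r) ∧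
    ∀ j, ‖q i - k j‖ ≤ r → 1 / (((nearCount k (q i) (c * r) : ℝ) - 1) * ell + 1) ≤ w i j

/-- `A` is the (possibly randomized) weight matrix of an ANNA mechanism with query and key
embeddings `Q, K` and parameters `r, c, ℓ, η`: as a function of the random seed `ω` (of law `μ`) and
of the input `X`, it gives non-negative weights whose rows sum to one, and for each input they
meet the two conditions of ANNA for all queries at once with probability at least `1 - η`. -/
structure IsANNA {N d m : ℕ} (Q K : (Fin d → ℝ) → EuclideanSpace ℝ (Fin m)) (r c ell η : ℝ)
    {Ω : Type} [MeasurableSpace Ω] (μ : Measure Ω)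
    (A : Ω → (Fin N → Fin d → ℝ) → Fin N → Fin N → ℝ) : Prop where
  measurable : ∀ X i j, Measurable fun ω => A ω X i j
  nonneg : ∀ ω X i j, 0 ≤ A ω X i j
  sum_eq_one : ∀ ω X i, ∑ j, A ω X i j = 1
  good : ∀ X, 1 - η ≤
    μ.real {ω | GoodWeights r c ell (fun i => Q (X i)) (fun i => K (X i)) (A ω X)}

/-! ### ANNA-transformers -/

/-- The data of a transformer with `L` layers, `H` heads per layer, embedding dimension `m` (of the
queries, keys and values) and token dimension `d`. The element-wise maps are arbitrary.
Two coordinates at least are needed to hold an input token and its position. -/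
structure Transformer (L H m d : ℕ) where
  two_le_d : 2 ≤ d
  Q : Fin L → Fin H → (Fin d → ℝ) → EuclideanSpace ℝ (Fin m)
  K : Fin L → Fin H → (Fin d → ℝ) → EuclideanSpace ℝ (Fin m)
  V : Fin L → Fin H → (Fin d → ℝ) → EuclideanSpace ℝ (Fin m)
  W : Fin L → Fin H → Matrix (Fin m) (Fin d) ℝ
  ψ : (Fin d → ℝ) → (Fin d → ℝ)

namespace Transformer

variable {L H m d : ℕ}

/-- Every number that an element-wise map or a matrix of the transformer produces is a fixed-point
number of scale `S`. -/
def HasPrecision (T : Transformer L H m d) (S : ℕ) : Prop :=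
  (∀ t h x a, IsFixedPoint S (T.Q t h x a)) ∧
  (∀ t h x a, IsFixedPoint S (T.K t h x a)) ∧
  (∀ t h x a, IsFixedPoint S (T.V t h x a)) ∧
  (∀ t h a b, IsFixedPoint S (T.W t h a b)) ∧
  (∀ x a, IsFixedPoint S (T.ψ x a))

/-- The attention layer `t`, with weights `w h` in head `h`: row `i` of the output is
`∑ₕ (∑ⱼ w h i j • V_h(X_j)) W_h`. -/
def layer (T : Transformer L H m d) {N : ℕ} (t : Fin L) (w : Fin H → Fin N → Fin N → ℝ)
    (X : Fin N → Fin d → ℝ) : Fin N → Fin d → ℝ :=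
  fun i b => ∑ h, ∑ a, (∑ j, w h i j * T.V t h (X j) a) * T.W t h a b

/-- The state after `t` layers on the input `X`, when head `h` of layer `t` uses the weights
`A t h (seed t)` and the output of each layer is rounded to fixed-point numbers of scale `S`. -/
def state (T : Transformer L H m d) (S : ℕ) {N : ℕ} {Ω : Type}
    (A : Fin L → Fin H → Ω → (Fin N → Fin d → ℝ) → Fin N → Fin N → ℝ) (seed : Fin L → Ω)
    (X : Fin N → Fin d → ℝ) : ℕ → Fin N → Fin d → ℝ
  | 0 => X
  | t + 1 =>
    if ht : t < L then
      fun i b => quantize S (T.layer ⟨t, ht⟩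
        (fun h => A ⟨t, ht⟩ h (seed ⟨t, ht⟩) (T.state S A seed X t)) (T.state S A seed X t) i b)
    else T.state S A seed X t

/-- The output of the transformer: `ψ`, row by row, on the state after the last layer. -/
def output (T : Transformer L H m d) (S : ℕ) {N : ℕ} {Ω : Type}
    (A : Fin L → Fin H → Ω → (Fin N → Fin d → ℝ) → Fin N → Fin N → ℝ) (seed : Fin L → Ω)
    (X : Fin N → Fin d → ℝ) (i : Fin N) : Fin d → ℝ :=
  T.ψ (T.state S A seed X L i)

end Transformer

/-! ### Words as inputs and outputs -/

/-- The number that stands for a letter, or for `⊥`: the letters are `1, …, |Σ|` in the order given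
by an enumeration `e` of the alphabet, and `⊥` is `0`. -/
def letterCode {α : Type*} [Fintype α] (e : α ≃ Fin (Fintype.card α)) : Option α → ℝ
  | none => 0
  | some a => ((e a : ℕ) : ℝ) + 1

/-- The input matrix of a word: row `i` is (letter, position, `0`, …, `0`). -/
def wordInput {α : Type*} [Fintype α] (e : α ≃ Fin (Fintype.card α)) {N : ℕ} (d : ℕ)
    (w : Fin N → α) : Fin N → Fin d → ℝ :=
  fun i b => if (b : ℕ) = 0 then letterCode e (some (w i))
    else if (b : ℕ) = 1 then ((i : ℕ) : ℝ) + 1 else 0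

/-- The required output row at the 0-based index `i` (position `i + 1`): the letter
`w_{σ^k(w, i + 1)}` in the first coordinate, and `0` in the others. -/
def kHopOutput {α : Type*} [Fintype α] [DecidableEq α] (e : α ≃ Fin (Fintype.card α)) {N : ℕ}
    (d k : ℕ) (w : Fin N → α) (i : Fin N) : Fin d → ℝ :=
  fun b => if (b : ℕ) = 0 then letterCode e (kHop w k ((i : ℕ) + 1)) else 0

end

noncomputable section

/-! Approximate nearest neighbor attention becomes exact lookup when queries and keys are integer
vectors and `c * r < 1`: a key within `c * r` of a query then equals it. If some row matches, good
weights vanish off the matching rows and are at least `1 / S` on them (`GoodWeights.exact`). The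
values of the weights remain unknown, but two facts survive averaging and rounding: a value common
to all matching rows is returned exactly, and the result is positive iff some matching row
contributes a positive number (`LookupSpec`, `lookupSpec_quantize`).

These two facts suffice for the task. One hop asks for the last earlier occurrence of a letter, and
is found by descending a tree with branching `B = ⌈N ^ ε'⌉ + 1` and depth `⌈1 / ε'⌉`. Given the
preceding coarse block that contains the letter, one layer looks up (letter, coarse block) both for
the row's own block and for that preceding block. The matching rows mark their sub-blocks in one-hot
form, and the positive marks show which sub-blocks are occupied (`precedingBlock_refine`). The
factor `B` is paid for by the dimension, the depth is constant. Then `k` hops are composed by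
repeated squaring along the binary digits of `k`, where a lookup by position has a unique match, and
a last lookup fetches the letter. Three heads are enough: two lookups, and one by which a row copies
its own registers.

For the probability, the state before a layer depends only on the seeds of earlier layers, so it may
be frozen when the guarantee of a head is applied. A union bound over the `L * H` heads finishes the
argument (`le_measureReal_headGood`). -/

/-! ### Fixed-point numbers and exact lookup -/

theorem isFixedPoint_natCast {S n : ℕ} (hS : 0 < S) (hn : n ≤ S) : IsFixedPoint S (n : ℝ) := by
  have hS' : (S : ℝ) ≠ 0 := by positivity
  refine ⟨⟨(n : ℤ) * S, ?_⟩, ?_⟩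
  · push_cast
    field_simp
  · rw [abs_of_nonneg (Nat.cast_nonneg n)]
    exact_mod_cast hn

theorem isFixedPoint_zero (S : ℕ) : IsFixedPoint S 0 := ⟨⟨0, by simp⟩, by simp⟩

theorem quantize_natCast {S n : ℕ} (hS : 0 < S) (hn : n ≤ S) : quantize S (n : ℝ) = n := by
  have hS' : (S : ℝ) ≠ 0 := by positivity
  have h1 : round ((n : ℝ) * S) = (n : ℤ) * S := by
    rw [← round_intCast (α := ℝ) ((n : ℤ) * S)]
    push_cast
    rfl
  have hn' : (n : ℝ) ≤ S := by exact_mod_cast hn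
  unfold quantize
  rw [h1]
  push_cast
  rw [mul_div_assoc, div_self hS', mul_one, min_eq_right hn', max_eq_right]
  linarith [(Nat.cast_nonneg n : (0 : ℝ) ≤ n), (Nat.cast_nonneg S : (0 : ℝ) ≤ S)]

theorem quantize_pos {S : ℕ} (hS : 0 < S) {x : ℝ} (hx : 1 / (S : ℝ) ≤ x) : 0 < quantize S x := by
  have hS' : (0 : ℝ) < S := by positivity
  have h1 : 1 ≤ round (x * S) := by
    have h2 : (1 : ℝ) ≤ x * S := by rwa [div_le_iff₀ hS'] at hx
    rw [round_eq, Int.le_floor]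
    push_cast
    linarith
  have h3 : (1 : ℝ) ≤ (round (x * S) : ℝ) := by exact_mod_cast h1
  refine lt_max_of_lt_right (lt_min hS' (by positivity))

/-- What a lookup of the rows that satisfy `hit` guarantees about one coordinate of its result,
when row `j` contributes the number `v j`. -/
def LookupSpec {N : ℕ} (hit : Fin N → Prop) (v : Fin N → ℕ) (y : ℝ) : Prop :=
  (∃ j, hit j) → ((0 < y ↔ ∃ j, hit j ∧ 0 < v j) ∧ ∀ n : ℕ, (∀ j, hit j → v j = n) → y = n)

/-- The average of a constant is that constant, a natural number that rounding fixes. A matching row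
with a positive entry contributes at least `1 / S`, which does not round to zero; if no matching row
has one, the constant case with value `0` applies. -/
theorem lookupSpec_quantize {N S : ℕ} (hS : 0 < S) {hit : Fin N → Prop} {v : Fin N → ℕ}
    (hv : ∀ j, v j ≤ S) {w : Fin N → ℝ} (h0 : ∀ j, 0 ≤ w j) (h1 : ∑ j, w j = 1)
    (hw : (∃ j, hit j) → (∀ j, ¬ hit j → w j = 0) ∧ ∀ j, hit j → 1 / (S : ℝ) ≤ w j) :
    LookupSpec hit v (quantize S (∑ j, w j * v j)) := by
  intro hex
  obtain ⟨hmiss, hhit⟩ := hw hex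
  have hconst : ∀ n : ℕ, (∀ j, hit j → v j = n) → quantize S (∑ j, w j * v j) = n := by
    intro n hn
    have : ∑ j, w j * (v j : ℝ) = n := by
      rw [← one_mul (n : ℝ), ← h1, Finset.sum_mul]
      refine Finset.sum_congr rfl fun j _ => ?_
      by_cases hj : hit j
      · rw [hn j hj]
      · rw [hmiss j hj, zero_mul, zero_mul]
    rw [this]
    obtain ⟨j, hj⟩ := hex
    exact quantize_natCast hS (hn j hj ▸ hv j)
  refine ⟨⟨fun hy => ?_, ?_⟩, hconst⟩
  · by_contra hcon
    push Not at hcon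
    have := hconst 0 fun j hj => Nat.le_zero.1 (hcon j hj)
    simp [this] at hy
  · rintro ⟨j, hj, hvj⟩
    refine quantize_pos hS ?_
    have h2 : (1 : ℝ) ≤ v j := by exact_mod_cast hvj
    calc 1 / (S : ℝ) ≤ w j := hhit j hj
      _ ≤ w j * v j := le_mul_of_one_le_right (h0 j) h2
      _ ≤ _ := Finset.single_le_sum (f := fun j => w j * (v j : ℝ))
        (fun j _ => mul_nonneg (h0 j) (Nat.cast_nonneg _)) (Finset.mem_univ j)

theorem nearCount_le {N m : ℕ} (k : Fin N → EuclideanSpace ℝ (Fin m))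
    (q : EuclideanSpace ℝ (Fin m)) (t : ℝ) : nearCount k q t ≤ N := by
  unfold nearCount
  exact (Nat.card_le_card_of_injective _ Subtype.val_injective).trans (by simp)

/-- If the keys that differ from a query are far away from it, then the good weights of the query
live on the equal keys, and are not too small there. -/
theorem GoodWeights.exact {N m a S : ℕ} {r c ell : ℝ} {q k : Fin N → EuclideanSpace ℝ (Fin m)}
    {w : Fin N → Fin N → ℝ} (hg : GoodWeights r c ell q k w) (h0 : ∀ i j, 0 ≤ w i j)
    (hr : 0 ≤ r) (hc : 1 ≤ c) (hell : 1 ≤ ell) (hella : ell ≤ ((N : ℝ) + 1) ^ a)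
    (hS : (N + 1) ^ (a + 1) ≤ S) (i : Fin N)
    (hsep : ∀ j, ‖q i - k j‖ ≤ c * r → q i = k j) (hex : ∃ j, k j = q i) :
    (∀ j, k j ≠ q i → w i j = 0) ∧ ∀ j, k j = q i → 1 / (S : ℝ) ≤ w i j := by
  have hcr : 0 ≤ c * r := by positivity
  obtain ⟨hg1, hg2⟩ := hg i
  constructor
  · intro j hj
    by_contra hne
    obtain ⟨j', hj'⟩ := hex
    have := hg1 ⟨j', by simpa [hj'] using hcr⟩ j (lt_of_le_of_ne (h0 i j) (Ne.symm hne))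
    exact hj (hsep j this).symm
  · intro j hj
    refine le_trans ?_ (hg2 j (by simpa [hj] using hr))
    have hn1 : 1 ≤ nearCount k (q i) (c * r) := by
      unfold nearCount
      have : Nonempty {j : Fin N // ‖q i - k j‖ ≤ c * r} := ⟨⟨j, by simpa [hj] using hcr⟩⟩
      exact Nat.card_pos
    have hn2 := nearCount_le k (q i) (c * r)
    have hn1' : (1 : ℝ) ≤ nearCount k (q i) (c * r) := by exact_mod_cast hn1
    have hn2' : (nearCount k (q i) (c * r) : ℝ) ≤ N := by exact_mod_cast hn2
    have hS' : ((N : ℝ) + 1) ^ (a + 1) ≤ S := by exact_mod_cast hS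
    -- The denominator is at most `(N - 1) * (N + 1) ^ a + 1`, hence at most `(N + 1) ^ (a + 1)`.
    refine one_div_le_one_div_of_le (by nlinarith) (le_trans ?_ hS')
    have hp : (1 : ℝ) ≤ ((N : ℝ) + 1) ^ a := hell.trans hella
    rw [pow_succ]
    nlinarith [mul_le_mul (sub_le_sub_right hn2' 1) hella (by linarith) (by linarith)]

/-! ### Measurability, and the union bound over the heads -/

/-- The weights are measurable in the seed only for each fixed input. To substitute a random input,
the preimage is split along the countably many values of that input. -/
theorem measurable_of_countable_range {Ω 𝒳 β : Type*} [MeasurableSpace Ω] [MeasurableSpace 𝒳]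
    [MeasurableSingletonClass 𝒳] [MeasurableSpace β] {f : Ω → 𝒳} (hf : Measurable f)
    (hc : (Set.range f).Countable) {g : Ω → 𝒳 → β} (hg : ∀ x, Measurable fun ω => g ω x) :
    Measurable fun ω => g ω (f ω) := by
  intro s hs
  have : (fun ω => g ω (f ω)) ⁻¹' s =
      ⋃ x ∈ Set.range f, f ⁻¹' {x} ∩ (fun ω => g ω x) ⁻¹' s := by
    ext ω
    simp only [Set.mem_preimage, Set.mem_iUnion, Set.mem_inter_iff, Set.mem_singleton_iff,
      exists_prop]
    exact ⟨fun h => ⟨_, ⟨ω, rfl⟩, rfl, h⟩, by rintro ⟨x, -, rfl, h⟩; exact h⟩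
  rw [this]
  exact MeasurableSet.biUnion hc fun x _ =>
    (hf (measurableSet_singleton x)).inter (hg x hs)

theorem measurable_quantize (S : ℕ) : Measurable (quantize S) := by
  unfold quantize
  have h : Measurable fun x : ℝ => ((round (x * S) : ℤ) : ℝ) := by
    simp only [round_eq]
    exact (measurable_from_top.comp Int.measurable_floor).comp (by fun_prop)
  fun_prop

theorem measurableSet_goodWeights {Ω : Type*} [MeasurableSpace Ω] {N m : ℕ} (r c ell : ℝ)
    (q k : Fin N → EuclideanSpace ℝ (Fin m)) {w : Ω → Fin N → Fin N → ℝ}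
    (hw : ∀ i j, Measurable fun ω => w ω i j) :
    MeasurableSet {ω | GoodWeights r c ell q k (w ω)} := by
  unfold GoodWeights
  refine measurableSet_setOfPred.2 <| Measurable.forall fun i => Measurable.and ?_ ?_
  · refine Measurable.imp measurable_const (Measurable.forall fun j => Measurable.imp ?_
      measurable_const)
    exact (measurableSet_lt measurable_const (hw i j)).mem
  · refine Measurable.forall fun j => Measurable.imp measurable_const ?_
    exact (measurableSet_le measurable_const (hw i j)).mem

namespace Transformer

variable {L H m d N : ℕ} {Ω : Type}

/-- This is the independence used below: the state that layer `t` reads does not involve the seed of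
layer `t`. -/
theorem state_congr (T : Transformer L H m d) (S : ℕ)
    (A : Fin L → Fin H → Ω → (Fin N → Fin d → ℝ) → Fin N → Fin N → ℝ) (X : Fin N → Fin d → ℝ)
    {seed seed' : Fin L → Ω} (t : ℕ) (h : ∀ s : Fin L, (s : ℕ) < t → seed s = seed' s) :
    T.state S A seed X t = T.state S A seed' X t := by
  induction t with
  | zero => rfl
  | succ t ih =>
    have ih' := ih fun s hs => h s (by omega)
    by_cases ht : t < L
    · simp only [state, dif_pos ht, ih', h ⟨t, ht⟩ (Nat.lt_succ_self t)]
    · simp only [state, dif_neg ht, ih']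

/-- Rounding confines each layer's output to a set indexed by integer matrices. -/
theorem countable_range_state (T : Transformer L H m d) (S : ℕ)
    (A : Fin L → Fin H → Ω → (Fin N → Fin d → ℝ) → Fin N → Fin N → ℝ) (X : Fin N → Fin d → ℝ)
    (t : ℕ) : (Set.range fun seed => T.state S A seed X t).Countable := by
  induction t with
  | zero => exact (Set.countable_singleton X).mono (by rintro _ ⟨_, rfl⟩; rfl)
  | succ t ih =>
    by_cases ht : t < L
    · refine (Set.countable_range fun z : Fin N → Fin d → ℤ => fun i b =>
        max (-(S : ℝ)) (min (S : ℝ) ((z i b : ℝ) / S))).mono ?_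
      rintro _ ⟨seed, rfl⟩
      refine ⟨fun i b => round (T.layer ⟨t, ht⟩
        (fun h => A ⟨t, ht⟩ h (seed ⟨t, ht⟩) (T.state S A seed X t))
        (T.state S A seed X t) i b * S), ?_⟩
      simp only [state, dif_pos ht]
      rfl
    · simpa only [state, dif_neg ht] using ih

theorem measurable_state [MeasurableSpace Ω] (T : Transformer L H m d) (S : ℕ)
    {A : Fin L → Fin H → Ω → (Fin N → Fin d → ℝ) → Fin N → Fin N → ℝ}
    (hA : ∀ t h X i j, Measurable fun ω => A t h ω X i j) (X : Fin N → Fin d → ℝ)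
    (t : ℕ) : Measurable fun seed => T.state S A seed X t := by
  induction t with
  | zero => exact measurable_const
  | succ t ih =>
    by_cases ht : t < L
    · simp only [state, dif_pos ht]
      refine measurable_of_countable_range
        (g := fun (seed : Fin L → Ω) x => fun i b => quantize S (T.layer ⟨t, ht⟩
          (fun h => A ⟨t, ht⟩ h (seed ⟨t, ht⟩) x) x i b)) ih
        (T.countable_range_state S A X t) fun x => ?_
      refine measurable_pi_lambda _ fun i => measurable_pi_lambda _ fun b => ?_
      refine (measurable_quantize S).comp ?_
      unfold layer
      refine Finset.measurable_sum _ fun h _ => Finset.measurable_sum _ fun a _ => ?_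
      refine Measurable.mul_const (Finset.measurable_sum _ fun j _ => ?_) _
      exact Measurable.mul_const ((hA _ h x i j).comp (measurable_pi_apply _)) _
    · simpa only [state, dif_neg ht] using ih

/-- Head `h` of layer `t` uses good weights in the computation on the input `X`. -/
def HeadGood (T : Transformer L H m d) (S : ℕ) (r c ell : ℝ)
    (A : Fin L → Fin H → Ω → (Fin N → Fin d → ℝ) → Fin N → Fin N → ℝ) (X : Fin N → Fin d → ℝ)
    (t : Fin L) (h : Fin H) (seed : Fin L → Ω) : Prop :=
  GoodWeights r c ell (fun i => T.Q t h (T.state S A seed X t i))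
    (fun i => T.K t h (T.state S A seed X t i)) (A t h (seed t) (T.state S A seed X t))

theorem measurableSet_headGood [MeasurableSpace Ω] (T : Transformer L H m d) (S : ℕ)
    {r c ell : ℝ} {A : Fin L → Fin H → Ω → (Fin N → Fin d → ℝ) → Fin N → Fin N → ℝ}
    (hA : ∀ t h X i j, Measurable fun ω => A t h ω X i j) (X : Fin N → Fin d → ℝ)
    (t : Fin L) (h : Fin H) : MeasurableSet {seed | T.HeadGood S r c ell A X t h seed} := by
  refine measurableSet_setOfPred.2 <| measurable_of_countable_range
    (g := fun (seed : Fin L → Ω) x => GoodWeights r c ell (fun i => T.Q t h (x i))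
      (fun i => T.K t h (x i)) (A t h (seed t) x))
    (T.measurable_state S hA X t) (T.countable_range_state S A X t) fun x => ?_
  exact (measurableSet_goodWeights r c ell _ _
    fun i j => (hA t h x i j).comp (measurable_pi_apply t)).mem

/-- By Fubini, the seeds of all layers but `t` are frozen. The state before layer `t` is then a
fixed matrix, to which the guarantee of the mechanism for a single input applies. -/
theorem measure_not_headGood_le [MeasurableSpace Ω] {μ : Measure Ω} [IsProbabilityMeasure μ]
    (T : Transformer L H m d) (S : ℕ) {r c ell η : ℝ}
    {A : Fin L → Fin H → Ω → (Fin N → Fin d → ℝ) → Fin N → Fin N → ℝ}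
    (hA : ∀ t h, IsANNA (T.Q t h) (T.K t h) r c ell η μ (A t h)) (X : Fin N → Fin d → ℝ)
    (t : Fin L) (h : Fin H) :
    (Measure.pi fun _ : Fin L => μ) {seed | ¬ T.HeadGood S r c ell A X t h seed} ≤
      ENNReal.ofReal η := by
  have hm := fun t h => (hA t h).measurable
  have hE := (T.measurableSet_headGood S (r := r) (c := c) (ell := ell) hm X t h).compl
  cases L with
  | zero => exact t.elim0
  | succ n =>
    have hmp := (measurePreserving_piFinSuccAbove (fun _ : Fin (n + 1) => μ) t).symm
    change (Measure.pi fun _ : Fin (n + 1) => μ) {seed | T.HeadGood S r c ell A X t h seed}ᶜ ≤ _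
    rw [← hmp.measure_preimage hE.nullMeasurableSet]
    rw [Measure.prod_apply_symm (hmp.measurable hE)]
    have hbound : ∀ y : Fin n → Ω, μ ((fun x => (x, y)) ⁻¹'
        ((MeasurableEquiv.piFinSuccAbove (fun _ : Fin (n + 1) => Ω) t).symm ⁻¹'
          {seed | T.HeadGood S r c ell A X t h seed}ᶜ)) ≤ ENNReal.ofReal η := by
      intro y
      rcases isEmpty_or_nonempty Ω with hΩ | ⟨⟨ω₀⟩⟩
      · simp [Measure.eq_zero_of_isEmpty μ]
      -- The seed `ω₀` in place `t` is arbitrary, since it does not affect the state before layer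
      -- `t`.
      set x := T.state S A (Fin.insertNth t ω₀ y) X t with hx
      have hstate : ∀ ω, T.state S A (Fin.insertNth t ω y : Fin (n + 1) → Ω) X t = x := by
        intro ω
        refine T.state_congr S A X t fun s hs => ?_
        obtain ⟨s', rfl⟩ := Fin.exists_succAbove_eq (x := s) (y := t) (by rintro rfl; omega)
        simp
      have hset : ((fun x => (x, y)) ⁻¹'
          ((MeasurableEquiv.piFinSuccAbove (fun _ : Fin (n + 1) => Ω) t).symm ⁻¹'
            {seed | T.HeadGood S r c ell A X t h seed}ᶜ)) =
          {ω | GoodWeights r c ell (fun i => T.Q t h (x i)) (fun i => T.K t h (x i))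
            (A t h ω x)}ᶜ := by
        ext ω
        have h1 : (MeasurableEquiv.piFinSuccAbove (fun _ : Fin (n + 1) => Ω) t).symm (ω, y) =
            Fin.insertNth t ω y := rfl
        simp only [Set.mem_preimage, Set.mem_compl_iff, Set.mem_ofPred_eq, h1, HeadGood, hstate,
          Fin.insertNth_apply_same]
      rw [hset]
      have hg := measurableSet_goodWeights r c ell (fun i => T.Q t h (x i))
        (fun i => T.K t h (x i)) (w := fun ω => A t h ω x) (fun i j => hm t h x i j)
      have h2 := (hA t h).good x
      have h3 := probReal_compl_eq_one_sub (μ := μ) hg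
      rw [← ofReal_measureReal]
      exact ENNReal.ofReal_le_ofReal (by linarith)
    refine (lintegral_mono hbound).trans ?_
    simp

/-- With probability at least `1 - L H η`, all heads of all layers use good weights. -/
theorem le_measureReal_headGood [MeasurableSpace Ω] {μ : Measure Ω} [IsProbabilityMeasure μ]
    (T : Transformer L H m d) (S : ℕ) {r c ell η : ℝ} (hη : 0 ≤ η)
    {A : Fin L → Fin H → Ω → (Fin N → Fin d → ℝ) → Fin N → Fin N → ℝ}
    (hA : ∀ t h, IsANNA (T.Q t h) (T.K t h) r c ell η μ (A t h)) (X : Fin N → Fin d → ℝ) :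
    1 - L * H * η ≤ (Measure.pi fun _ : Fin L => μ).real
      {seed | ∀ t h, T.HeadGood S r c ell A X t h seed} := by
  have hm := fun t h => (hA t h).measurable
  have hG : MeasurableSet {seed | ∀ t h, T.HeadGood S r c ell A X t h seed} :=
    measurableSet_setOfPred.2 <| Measurable.forall fun t => Measurable.forall fun h =>
      (T.measurableSet_headGood S hm X t h).mem
  have hcompl := probReal_compl_eq_one_sub (μ := Measure.pi fun _ : Fin L => μ) hG
  have hle : (Measure.pi fun _ : Fin L => μ).real
      {seed | ∀ t h, T.HeadGood S r c ell A X t h seed}ᶜ ≤ L * H * η := by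
    have hsub : {seed | ∀ t h, T.HeadGood S r c ell A X t h seed}ᶜ ⊆
        ⋃ p : Fin L × Fin H, {seed | ¬ T.HeadGood S r c ell A X p.1 p.2 seed} := by
      intro seed hs
      simp only [Set.mem_compl_iff, Set.mem_ofPred_eq, not_forall] at hs
      obtain ⟨t, h, hs⟩ := hs
      exact Set.mem_iUnion.2 ⟨(t, h), hs⟩
    calc _ ≤ _ := measureReal_mono hsub
      _ ≤ ∑ p : Fin L × Fin H, (Measure.pi fun _ : Fin L => μ).real
          {seed | ¬ T.HeadGood S r c ell A X p.1 p.2 seed} := measureReal_iUnion_fintype_le _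
      _ ≤ ∑ _p : Fin L × Fin H, η := by
        refine Finset.sum_le_sum fun p _ => ?_
        exact ENNReal.toReal_le_of_le_ofReal hη (T.measure_not_headGood_le S hA X p.1 p.2)
      _ = L * H * η := by simp
  linarith

end Transformer

/-! ### Table programs -/

/-- The registers of a row. Register `0` holds the letter and register `1` the position. -/
abbrev Registers := Fin 4 → ℕ

/-- One step of a program in which every row of a table of registers looks up two keys.
The rows whose key equals the query of the row contribute `B` numbers each, and from its
registers and the aggregated numbers the row computes its new registers. -/
structure TableLayer (B : ℕ) where
  query : Fin 2 → Registers → ℕ × ℕ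
  key : Fin 2 → Registers → ℕ × ℕ
  value : Fin 2 → Registers → Fin B → ℕ
  update : Registers → (Fin 2 → Fin B → ℝ) → Registers

namespace TableLayer

variable {B N : ℕ}

/-- The step leads from the table `R` to the table `R'`, however the lookups aggregate. -/
def Computes (l : TableLayer B) (R R' : Fin N → Registers) : Prop :=
  ∀ i y, (∀ h g, LookupSpec (fun j => l.key h (R j) = l.query h (R i))
    (fun j => l.value h (R j) g) (y h g)) → l.update (R i) y = R' i

/-- All numbers that the step handles on the table `R` are at most `S`. -/
structure Bounded (l : TableLayer B) (S : ℕ) (R : Fin N → Registers) : Prop where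
  register : ∀ i r, R i r ≤ S
  query : ∀ h i, (l.query h (R i)).1 ≤ S ∧ (l.query h (R i)).2 ≤ S
  key : ∀ h i, (l.key h (R i)).1 ≤ S ∧ (l.key h (R i)).2 ≤ S
  value : ∀ h i g, l.value h (R i) g ≤ S

/-- The queries of the three heads: head `0` looks up the position of the row itself. -/
def headQuery (l : TableLayer B) (h : Fin 3) : Registers → ℕ × ℕ :=
  Fin.cases (fun ρ => (ρ 1, 0)) l.query h

/-- The keys of the three heads. -/
def headKey (l : TableLayer B) (h : Fin 3) : Registers → ℕ × ℕ :=
  Fin.cases (fun ρ => (ρ 1, 0)) l.key h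

/-- The roles of the coordinates of a token: registers, and results of the two lookups. -/
def slot (B : ℕ) : Fin (4 + 2 * B) ≃ Fin 4 ⊕ Fin 2 × Fin B :=
  finSumFinEquiv.symm.trans (Equiv.sumCongr (Equiv.refl _) finProdFinEquiv.symm)

/-- The head that writes a coordinate. -/
def owner (b : Fin (4 + 2 * B)) : Fin 3 :=
  Sum.elim (fun _ => 0) (fun p => p.1.succ) (slot B b)

/-- The number that a row contributes to a coordinate. -/
def entry (l : TableLayer B) (ρ : Registers) (b : Fin (4 + 2 * B)) : ℕ :=
  Sum.elim ρ (fun p => l.value p.1 ρ p.2) (slot B b)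

end TableLayer

/-! ### Running a table program on a transformer -/

/-- A pair of numbers as a vector of numbers that are at most `S`. -/
def embedPair (S n : ℕ) (p : ℕ × ℕ) : EuclideanSpace ℝ (Fin (4 + n)) :=
  WithLp.toLp 2 fun a => ((if a = 0 then min p.1 S else if a = 1 then min p.2 S else 0 : ℕ) : ℝ)

theorem isFixedPoint_embedPair {S n : ℕ} (hS : 0 < S) (p : ℕ × ℕ) (a : Fin (4 + n)) :
    IsFixedPoint S (embedPair S n p a) := by
  refine isFixedPoint_natCast hS ?_
  split_ifs <;> simp

/-- Each coordinate of the difference is an integer of absolute value less than `1`. The bounds on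
the entries make the cap at `S` inactive. -/
theorem eq_of_norm_embedPair_sub_lt {S n : ℕ} {p q : ℕ × ℕ} (hp : p.1 ≤ S ∧ p.2 ≤ S)
    (hq : q.1 ≤ S ∧ q.2 ≤ S) (h : ‖embedPair S n p - embedPair S n q‖ < 1) : p = q := by
  have key : ∀ x y : ℕ, |(x : ℝ) - y| < 1 → x = y := by
    intro x y hxy
    have : |(x : ℤ) - y| < 1 := by exact_mod_cast hxy
    have := Int.abs_lt_one_iff.1 this
    omega
  have hcoord := fun a => (PiLp.norm_apply_le (embedPair S n p - embedPair S n q) a).trans_lt h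
  have h0 := hcoord 0
  have h1 := hcoord 1
  have h10 : (1 : Fin (4 + n)) ≠ 0 := by
    intro h
    have h2 := congrArg Fin.val h
    rw [Fin.val_one', Fin.val_zero, Nat.mod_eq_of_lt (by omega)] at h2
    exact one_ne_zero h2
  simp only [embedPair, PiLp.sub_apply, if_true, if_neg h10, Real.norm_eq_abs,
    min_eq_left hp.1, min_eq_left hp.2, min_eq_left hq.1, min_eq_left hq.2] at h0 h1
  exact Prod.ext (key _ _ h0) (key _ _ h1)

/-- A program of table steps. -/
abbrev TableProgram (B : ℕ) := ℕ → TableLayer B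

namespace TableProgram

open TableLayer

variable {B N : ℕ}

/-- The registers that a token holds after `t` layers. -/
def decode (P : TableProgram B) : ℕ → (Fin (4 + 2 * B) → ℝ) → Registers
  | 0, x => ![⌊x 0⌋₊, ⌊x 1⌋₊, 0, ⌊x 1⌋₊]
  | t + 1, x => (P t).update (fun r => ⌊x ((slot B).symm (Sum.inl r))⌋₊)
      fun h g => x ((slot B).symm (Sum.inr (h, g)))

/-- The transformer that runs the first `L` steps of a program and outputs register `2`. -/
def toTransformer (P : TableProgram B) (L S : ℕ) :
    Transformer L 3 (4 + 2 * B) (4 + 2 * B) where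
  two_le_d := by omega
  Q t h x := embedPair S (2 * B) ((P t).headQuery h (P.decode t x))
  K t h x := embedPair S (2 * B) ((P t).headKey h (P.decode t x))
  V t h x := WithLp.toLp 2 fun b =>
    ((if owner b = h then min ((P t).entry (P.decode t x) b) S else 0 : ℕ) : ℝ)
  W _ _ := 1
  ψ x b := ((if b = 0 then min (P.decode L x 2) S else 0 : ℕ) : ℝ)

theorem hasPrecision_toTransformer (P : TableProgram B) (L : ℕ) {S : ℕ} (hS : 0 < S) :
    (P.toTransformer L S).HasPrecision S := by
  refine ⟨fun t h x a => isFixedPoint_embedPair hS _ a,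
    fun t h x a => isFixedPoint_embedPair hS _ a, fun t h x a => ?_, fun t h a b => ?_,
    fun x a => ?_⟩
  · refine isFixedPoint_natCast hS ?_
    split_ifs <;> simp
  · change IsFixedPoint S ((1 : Matrix _ _ ℝ) a b)
    rw [Matrix.one_apply]
    split_ifs
    · exact_mod_cast isFixedPoint_natCast (n := 1) hS hS
    · exact isFixedPoint_zero S
  · refine isFixedPoint_natCast hS ?_
    split_ifs <;> simp

/-- The output matrices are the identity, and the values of a head vanish outside the coordinates it
owns, so the sum over heads has one term per coordinate. -/
theorem layer_toTransformer (P : TableProgram B) {L S : ℕ} (t : Fin L)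
    (w : Fin 3 → Fin N → Fin N → ℝ) (X : Fin N → Fin (4 + 2 * B) → ℝ) (i : Fin N)
    (b : Fin (4 + 2 * B)) :
    (P.toTransformer L S).layer t w X i b =
      ∑ j, w (owner b) i j * (min ((P t).entry (P.decode t (X j)) b) S : ℕ) := by
  simp only [Transformer.layer, toTransformer, Matrix.one_apply, mul_ite, mul_one, mul_zero,
    Finset.sum_ite_eq', Finset.mem_univ, if_true]
  rw [Finset.sum_eq_single (owner b)]
  · simp
  · intro h _ hne
    simp [Ne.symm hne]
  · simp

/-- Under the bounds of the step no cap is active, so equality of embedded pairs is equality of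
pairs, and the good weights of each head perform an exact lookup. -/
theorem lookupSpec_state (P : TableProgram B) {L S a : ℕ} (hS : (N + 1) ^ (a + 1) ≤ S)
    {R : Fin N → Registers} {t : ℕ} (ht : t < L)
    (hb : (P t).Bounded S R) {r c ell : ℝ} (hr : 0 ≤ r) (hc : 1 ≤ c) (hcr : c * r < 1)
    (hell : 1 ≤ ell) (hella : ell ≤ ((N : ℝ) + 1) ^ a) {Ω : Type}
    {A : Fin L → Fin 3 → Ω → (Fin N → Fin (4 + 2 * B) → ℝ) → Fin N → Fin N → ℝ}
    (h0 : ∀ t h ω X i j, 0 ≤ A t h ω X i j) (h1 : ∀ t h ω X i, ∑ j, A t h ω X i j = 1)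
    {X : Fin N → Fin (4 + 2 * B) → ℝ} {seed : Fin L → Ω}
    (hgood : ∀ h, (P.toTransformer L S).HeadGood S r c ell A X ⟨t, ht⟩ h seed)
    (hR : ∀ i, P.decode t ((P.toTransformer L S).state S A seed X t i) = R i)
    (i : Fin N) (b : Fin (4 + 2 * B)) :
    LookupSpec (fun j => (P t).headKey (owner b) (R j) = (P t).headQuery (owner b) (R i))
      (fun j => (P t).entry (R j) b)
      ((P.toTransformer L S).state S A seed X (t + 1) i b) := by
  have hS0 : 0 < S := lt_of_lt_of_le (by positivity) hS
  have hentry : ∀ j, (P t).entry (R j) b ≤ S := by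
    intro j
    unfold entry
    rcases slot B b with r | p
    · exact hb.register j r
    · exact hb.value p.1 j p.2
  have hq : ∀ h i, ((P t).headQuery h (R i)).1 ≤ S ∧ ((P t).headQuery h (R i)).2 ≤ S := by
    intro h i
    cases h using Fin.cases with
    | zero => exact ⟨hb.register i 1, Nat.zero_le _⟩
    | succ h => exact hb.query h i
  have hk : ∀ h i, ((P t).headKey h (R i)).1 ≤ S ∧ ((P t).headKey h (R i)).2 ≤ S := by
    intro h i
    cases h using Fin.cases with
    | zero => exact ⟨hb.register i 1, Nat.zero_le _⟩
    | succ h => exact hb.key h i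
  have hval : (P.toTransformer L S).state S A seed X (t + 1) i b = quantize S
      (∑ j, A ⟨t, ht⟩ (owner b) (seed ⟨t, ht⟩) ((P.toTransformer L S).state S A seed X t) i j *
        ((P t).entry (R j) b : ℕ)) := by
    simp only [Transformer.state, dif_pos ht, layer_toTransformer, hR]
    simp only [min_eq_left (hentry _)]
  rw [hval]
  refine lookupSpec_quantize hS0 hentry (fun j => h0 _ _ _ _ i j) (h1 _ _ _ _ i) ?_
  rintro ⟨j₀, hj₀⟩
  have hg := hgood (owner b)
  have hQ : ∀ i, (P.toTransformer L S).Q ⟨t, ht⟩ (owner b)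
      ((P.toTransformer L S).state S A seed X t i) =
      embedPair S (2 * B) ((P t).headQuery (owner b) (R i)) := fun i => by rw [← hR i]; rfl
  have hK : ∀ i, (P.toTransformer L S).K ⟨t, ht⟩ (owner b)
      ((P.toTransformer L S).state S A seed X t i) =
      embedPair S (2 * B) ((P t).headKey (owner b) (R i)) := fun i => by rw [← hR i]; rfl
  simp only [Transformer.HeadGood, hQ, hK] at hg
  have hiff : ∀ j, embedPair S (2 * B) ((P t).headKey (owner b) (R j)) =
      embedPair S (2 * B) ((P t).headQuery (owner b) (R i)) ↔
      (P t).headKey (owner b) (R j) = (P t).headQuery (owner b) (R i) := by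
    refine fun j => ⟨fun h => ?_, fun h => by rw [h]⟩
    exact eq_of_norm_embedPair_sub_lt (n := 2 * B) (hk _ j) (hq _ i) (by rw [h]; simp)
  have hex := hg.exact (h0 _ _ _ _) hr hc hell hella hS i (fun j hj =>
    congrArg _ (eq_of_norm_embedPair_sub_lt (hq _ i) (hk _ j) (hj.trans_lt hcr)))
    ⟨j₀, (hiff j₀).2 hj₀⟩
  exact ⟨fun j hj => hex.1 j (fun h => hj ((hiff j).1 h)), fun j hj => hex.2 j ((hiff j).2 hj)⟩

/-- A layer has no residual connection: old registers reach the next layer only because head `0`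
copies them. The update itself is performed when the next layer decodes its tokens. -/
theorem decode_state (P : TableProgram B) {L S a : ℕ} (hS : (N + 1) ^ (a + 1) ≤ S)
    {R : ℕ → Fin N → Registers} (hpos : ∀ t i, R t i 1 = (i : ℕ) + 1)
    (hb : ∀ t < L, (P t).Bounded S (R t)) (hcomp : ∀ t < L, (P t).Computes (R t) (R (t + 1)))
    {r c ell : ℝ} (hr : 0 ≤ r) (hc : 1 ≤ c) (hcr : c * r < 1)
    (hell : 1 ≤ ell) (hella : ell ≤ ((N : ℝ) + 1) ^ a) {Ω : Type}
    {A : Fin L → Fin 3 → Ω → (Fin N → Fin (4 + 2 * B) → ℝ) → Fin N → Fin N → ℝ}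
    (h0 : ∀ t h ω X i j, 0 ≤ A t h ω X i j) (h1 : ∀ t h ω X i, ∑ j, A t h ω X i j = 1)
    {X : Fin N → Fin (4 + 2 * B) → ℝ} {seed : Fin L → Ω}
    (hgood : ∀ t h, (P.toTransformer L S).HeadGood S r c ell A X t h seed)
    (hX : ∀ i, P.decode 0 (X i) = R 0 i) (t : ℕ) (htL : t ≤ L) (i : Fin N) :
    P.decode t ((P.toTransformer L S).state S A seed X t i) = R t i := by
  induction t generalizing i with
  | zero => exact hX i
  | succ t ih =>
    have ht : t < L := htL
    have hspec := P.lookupSpec_state hS ht (hb t ht) hr hc hcr hell hella h0 h1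
      (hgood ⟨t, ht⟩) (ih ht.le) i
    set x := (P.toTransformer L S).state S A seed X (t + 1) i
    have hreg : ∀ ρ, x ((slot B).symm (Sum.inl ρ)) = R t i ρ := by
      intro ρ
      have h2 := hspec ((slot B).symm (Sum.inl ρ))
      simp only [owner, entry, Equiv.apply_symm_apply, Sum.elim_inl] at h2
      -- The key of head `0` is the position, so row `i` matches only itself and its registers come
      -- back unchanged.
      refine (h2 ⟨i, rfl⟩).2 _ fun j hj => ?_
      have h3 : R t j 1 = R t i 1 := congrArg Prod.fst hj
      rw [hpos, hpos] at h3
      rw [Fin.ext (Nat.succ_injective h3)]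
    have hdec : P.decode (t + 1) x = (P t).update (R t i)
        fun h g => x ((slot B).symm (Sum.inr (h, g))) := by
      simp only [decode, hreg, Nat.floor_natCast]
    rw [hdec]
    refine hcomp t ht i _ fun h g => ?_
    have h2 := hspec ((slot B).symm (Sum.inr (h, g)))
    simp only [owner, entry, Equiv.apply_symm_apply, Sum.elim_inr] at h2
    exact h2

end TableProgram

/-! ### The nearest earlier block that contains the letter -/

/-- For letters `l` and block numbers `p`, the largest block number below `p i` of a row with
letter `l i`, increased by `2`, and `0` if there is none. -/
def precedingBlock {N : ℕ} (l p : Fin N → ℕ) (i : Fin N) : ℕ :=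
  (Finset.univ.filter fun j => l j = l i ∧ p j < p i).sup fun j => p j + 2

section precedingBlock

variable {N : ℕ} {l p : Fin N → ℕ}

theorem le_precedingBlock {i j : Fin N} (h : l j = l i) (hp : p j < p i) :
    p j + 2 ≤ precedingBlock l p i :=
  Finset.le_sup (f := fun j => p j + 2) (by simp [h, hp])

theorem exists_eq_precedingBlock {i : Fin N} (h : precedingBlock l p i ≠ 0) :
    ∃ j, l j = l i ∧ p j < p i ∧ precedingBlock l p i = p j + 2 := by
  have hne : (Finset.univ.filter fun j => l j = l i ∧ p j < p i).Nonempty := by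
    by_contra hcon
    rw [Finset.not_nonempty_iff_eq_empty] at hcon
    exact h (by simp [precedingBlock, hcon])
  obtain ⟨j, hj, hj'⟩ := Finset.exists_mem_eq_sup _ hne fun j => p j + 2
  simp only [Finset.mem_filter, Finset.mem_univ, true_and] at hj
  exact ⟨j, hj.1, hj.2, hj'⟩

theorem precedingBlock_le (i : Fin N) : precedingBlock l p i ≤ p i + 1 := by
  refine Finset.sup_le fun j hj => ?_
  simp only [Finset.mem_filter, Finset.mem_univ, true_and] at hj
  omega

/-- The preceding block can be found among the blocks inside the own coarse block, and those inside
the preceding coarse block. -/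
theorem precedingBlock_refine {B : ℕ} (hB : 0 < B) (i : Fin N) {u : ℕ} (hu : u = precedingBlock l (fun j => p j / B) i)
    (s₁ s₂ : Finset (Fin B))
    (h₁ : ∀ g, g ∈ s₁ ↔ (g : ℕ) < p i % B ∧ ∃ j, (l j = l i ∧ p j / B = p i / B) ∧ p j % B = g)
    (h₂ : u ≠ 0 → ∀ g, g ∈ s₂ ↔
      ∃ j, (l j = l i ∧ p j / B = u - 2) ∧ p j % B = g) :
    precedingBlock l p i = max (s₁.sup fun g => p i / B * B + g + 2)
      (if u = 0 then 0 else
        s₂.sup fun g => (u - 2) * B + g + 2) := by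
  have hdm : ∀ j, p j / B * B + p j % B = p j := fun j => by
    rw [mul_comm]; exact Nat.div_add_mod _ _
  have hmod : ∀ j, p j % B < B := fun j => Nat.mod_lt _ hB
  apply le_antisymm
  · refine Finset.sup_le fun j hj => ?_
    simp only [Finset.mem_filter, Finset.mem_univ, true_and] at hj
    obtain ⟨hl, hlt⟩ := hj
    -- Either `j` lies in the coarse block of `i`, and `s₁` sees it, or in an earlier one.
    rcases (Nat.div_le_div_right (c := B) hlt.le).eq_or_lt with heq | hlt'
    · refine le_max_of_le_left ?_
      have hlt2 : p j % B < p i % B := by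
        have := hdm j; have := hdm i; rw [heq] at *; omega
      have := Finset.le_sup (f := fun g : Fin B => p i / B * B + (g : ℕ) + 2)
        ((h₁ ⟨p j % B, hmod j⟩).2 ⟨hlt2, j, ⟨hl, heq⟩, rfl⟩)
      refine le_trans (le_of_eq ?_) this
      simp only
      rw [← heq, hdm]
    · refine le_max_of_le_right ?_
      have hle : p j / B + 2 ≤ u := hu ▸
        le_precedingBlock (p := fun j => p j / B) hl hlt'
      have hne : u ≠ 0 := (lt_of_lt_of_le (Nat.succ_pos _) hle).ne'
      rw [if_neg hne]
      obtain ⟨j', hl', -, hj'⟩ := exists_eq_precedingBlock (hu ▸ hne)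
      replace hj' : u = p j' / B + 2 := hu.trans hj'
      have hmem : ∀ j'', l j'' = l i → p j'' / B = p j' / B →
          p j'' + 2 ≤ s₂.sup fun g => (u - 2) * B + g + 2 := by
        intro j'' hl'' hp''
        have := Finset.le_sup
          (f := fun g : Fin B => (u - 2) * B + (g : ℕ) + 2)
          ((h₂ hne ⟨p j'' % B, hmod j''⟩).2 ⟨j'', ⟨hl'', by rw [hp'', hj', Nat.add_sub_cancel]⟩, rfl⟩)
        refine le_trans (le_of_eq ?_) this
        simp only
        rw [hj', Nat.add_sub_cancel, ← hp'', hdm]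
      -- If `j` lies before the preceding coarse block, the row `j'` inside that block is a later
      -- candidate and dominates it.
      rcases eq_or_lt_of_le (Nat.le_of_add_le_add_right (hj' ▸ hle)) with heq | hlt2
      · exact hmem j hl heq
      · refine le_trans ?_ (hmem j' hl' rfl)
        have : p j < p j' := by
          by_contra hcon
          exact absurd (Nat.div_le_div_right (c := B) (not_lt.1 hcon)) (not_le.2 hlt2)
        omega
  · refine max_le (Finset.sup_le fun g hg => ?_) ?_
    · obtain ⟨hlt, j, ⟨hl, hp⟩, hj⟩ := (h₁ g).1 hg
      rw [← hp, ← hj, hdm]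
      refine le_precedingBlock hl ?_
      rw [← hdm j, ← hdm i, hp, hj]
      omega
    · split_ifs with h0
      · exact Nat.zero_le _
      refine Finset.sup_le fun g hg => ?_
      obtain ⟨j, ⟨hl, hp⟩, hj⟩ := (h₂ h0 g).1 hg
      rw [← hp, ← hj, hdm]
      refine le_precedingBlock hl ?_
      obtain ⟨j', -, hlt, hj'⟩ := exists_eq_precedingBlock (hu ▸ h0)
      change p j' / B < p i / B at hlt
      replace hj' : u = p j' / B + 2 := hu.trans hj'
      have hlt' : p j / B < p i / B := by rwa [hp, hj', Nat.add_sub_cancel]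
      by_contra hcon
      exact absurd (Nat.div_le_div_right (c := B) (not_lt.1 hcon)) (not_le.2 hlt')

end precedingBlock

/-! ### Steps of the program -/

namespace TableLayer

open Classical in
/-- Refines the preceding block, from blocks of length `B ^ (s + 1)` to blocks of length `B ^ s`. -/
def refineStep (B s : ℕ) : TableLayer B where
  query h ρ := (ρ 0, if h = 0 then (ρ 1 - 1) / B ^ s / B else ρ 2 - 2)
  key _ ρ := (ρ 0, (ρ 1 - 1) / B ^ s / B)
  value _ ρ g := if (ρ 1 - 1) / B ^ s % B = g then 1 else 0
  update ρ y := ![ρ 0, ρ 1,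
    max ((Finset.univ.filter fun g : Fin B => (g : ℕ) < (ρ 1 - 1) / B ^ s % B ∧ 0 < y 0 g).sup
        fun g => (ρ 1 - 1) / B ^ s / B * B + g + 2)
      (if ρ 2 = 0 then 0 else
        (Finset.univ.filter fun g : Fin B => 0 < y 1 g).sup fun g => (ρ 2 - 2) * B + g + 2),
    ρ 1]

/-- Doubles the number of hops of register `2`, and composes register `3` with it if `bit` says
so. -/
def doubleStep (n : ℕ) (bit : Bool) : TableLayer (n + 1) where
  query h ρ := (if h = 0 then ρ 2 else ρ 3, 0)
  key _ ρ := (ρ 1, 0)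
  value _ ρ _ := ρ 2
  update ρ y := ![ρ 0, ρ 1, if ρ 2 = 0 then 0 else ⌊y 0 0⌋₊,
    if bit then (if ρ 3 = 0 then 0 else ⌊y 1 0⌋₊) else ρ 3]

/-- Fetches the letter at the position in register `3`. -/
def fetchStep (n : ℕ) : TableLayer (n + 1) where
  query _ ρ := (ρ 3, 0)
  key _ ρ := (ρ 1, 0)
  value _ ρ _ := ρ 0
  update ρ y := ![ρ 0, ρ 1, if ρ 3 = 0 then 0 else ⌊y 0 0⌋₊, ρ 3]

/-- The table with letters `l`, and further registers given by functions of the position. -/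
def table {N : ℕ} (l : Fin N → ℕ) (u v : Fin N → ℕ) : Fin N → Registers :=
  fun i => ![l i, i + 1, u i, v i]

variable {N n : ℕ} {l : Fin N → ℕ}

/-- The marks are one-hot, so coordinate `g` of a lookup is positive iff some matching row lies in
sub-block `g`. Only this sign is used; the averages themselves depend on the unknown weights. -/
theorem computes_refineStep {B : ℕ} (hB : 0 < B) (s : ℕ) :
    (refineStep B s).Computes
      (table l (precedingBlock l fun j => (j : ℕ) / B ^ (s + 1)) fun j => j + 1)
      (table l (precedingBlock l fun j => (j : ℕ) / B ^ s) fun j => j + 1) := by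
  intro i y hy
  have hpow : (fun j : Fin N => (j : ℕ) / B ^ (s + 1)) = fun j : Fin N => (j : ℕ) / B ^ s / B := by
    funext j
    rw [Nat.div_div_eq_div_mul, pow_succ]
  rw [hpow] at hy ⊢
  have hmark : ∀ h : Fin 2, ∀ x : ℕ,
      ((refineStep B s).query h (table l (precedingBlock l fun j => (j : ℕ) / B ^ s / B)
        (fun j => j + 1) i)) = (l i, x) → (∃ j, l j = l i ∧ (j : ℕ) / B ^ s / B = x) → ∀ g,
      0 < y h g ↔ ∃ j : Fin N, (l j = l i ∧ (j : ℕ) / B ^ s / B = x) ∧ (j : ℕ) / B ^ s % B = g := by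
    intro h x hx hex g
    have h1 := hy h g
    rw [hx] at h1
    simp only [refineStep, table, LookupSpec, Prod.mk.injEq, Matrix.cons_val_zero,
      Matrix.cons_val_one, Nat.add_sub_cancel] at h1
    rw [(h1 hex).1]
    refine exists_congr fun j => and_congr_right fun _ => ?_
    split_ifs with hg <;> simp [hg]
  have hmain := precedingBlock_refine hB (l := l) (p := fun j : Fin N => (j : ℕ) / B ^ s) i rfl
    (Finset.univ.filter fun g : Fin B => (g : ℕ) < (i : ℕ) / B ^ s % B ∧ 0 < y 0 g)
    (Finset.univ.filter fun g : Fin B => 0 < y 1 g) (fun g => by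
      simp only [Finset.mem_filter, Finset.mem_univ, true_and]
      -- The row `i` itself makes the first lookup nonempty.
      rw [hmark 0 ((i : ℕ) / B ^ s / B) rfl ⟨i, rfl, rfl⟩ g])
    (fun hne g => by
      simp only [Finset.mem_filter, Finset.mem_univ, true_and]
      -- A row that attains the preceding coarse block makes the second lookup nonempty; this is
      -- where a nonzero register is needed.
      obtain ⟨j, hl, -, hj⟩ := exists_eq_precedingBlock hne
      change precedingBlock l _ i = (j : ℕ) / B ^ s / B + 2 at hj
      rw [hmark 1 _ rfl ⟨j, hl, (Nat.sub_eq_of_eq_add hj).symm⟩ g]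
      rfl)
  funext k
  fin_cases k
  · rfl
  · rfl
  · exact hmain.symm
  · rfl

/-- Positions are distinct, so exactly one row matches and its value is the common value. -/
theorem LookupSpec.eq_of_pointer {N : ℕ} {v : Fin N → ℕ} {y : ℝ} {q : ℕ}
    (h : LookupSpec (fun j : Fin N => ((j : ℕ) + 1, 0) = (q, 0)) v y) {j : Fin N}
    (hj : (j : ℕ) + 1 = q) : y = v j := by
  refine (h ⟨j, by simp [hj]⟩).2 _ fun j' hj' => ?_
  have h1 := congrArg Prod.fst hj'
  simp only at h1
  rw [Fin.ext (show (j' : ℕ) = j by omega)]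

theorem iterate_le {f : ℕ → ℕ} (hf : ∀ x, f x ≤ x) (a x : ℕ) : f^[a] x ≤ x := by
  induction a generalizing x with
  | zero => exact le_rfl
  | succ a ih => exact (ih (f x)).trans (hf x)

/-- Row `q` stores `f^[a] q`, so following a pointer to `q` composes with `f^[a]`. No row has
position `0`, so that pointer is treated apart; it is a fixed point because `f x ≤ x`. -/
theorem computes_doubleStep {f : ℕ → ℕ} (hf : ∀ x, f x ≤ x) (bit : Bool) (a b : ℕ) :
    (doubleStep n bit).Computes
      (table l (fun j => f^[a] (j + 1)) fun j => f^[b] (j + 1))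
      (table l (fun j => f^[a + a] (j + 1))
        fun j => f^[if bit then a + b else b] (j + 1)) := by
  intro i y hy
  have hptr : ∀ (h : Fin 2) (q : ℕ), (doubleStep n bit).query h (table l
      (fun j => f^[a] (j + 1)) (fun j => f^[b] (j + 1)) i) = (q, 0) → q ≠ 0 → q ≤ N →
      ⌊y h 0⌋₊ = f^[a] q := by
    intro h q hq h0 hN
    have h1 := hy h 0
    rw [hq] at h1
    have h2 := LookupSpec.eq_of_pointer h1 (j := ⟨q - 1, by omega⟩)
      (by simp only; omega)
    rw [h2, Nat.floor_natCast]
    simp only [doubleStep, table, Matrix.cons_val]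
    congr 1
    omega
  have hzero : f^[a] 0 = 0 := Nat.le_zero.1 (iterate_le hf a 0)
  have hle : ∀ a, f^[a] (i + 1) ≤ N := fun a => (iterate_le hf a _).trans i.2
  funext k
  fin_cases k
  · rfl
  · rfl
  · change (if f^[a] (i + 1) = 0 then 0 else ⌊y 0 0⌋₊) = f^[a + a] (i + 1)
    rw [Function.iterate_add_apply]
    split_ifs with h0
    · rw [h0, hzero]
    · exact hptr 0 _ rfl h0 (hle a)
  · change (if bit then (if f^[b] (i + 1) = 0 then 0 else ⌊y 1 0⌋₊) else f^[b] (i + 1)) =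
      f^[if bit then a + b else b] (i + 1)
    cases bit with
    | false => rfl
    | true =>
      simp only [if_true]
      rw [Function.iterate_add_apply]
      split_ifs with h0
      · rw [h0, hzero]
      · exact hptr 1 _ rfl h0 (hle b)

theorem computes_fetchStep {u v : Fin N → ℕ} (hv : ∀ i, v i ≤ N) :
    (fetchStep n).Computes (table l u v)
      (table l (fun i => if h : v i - 1 < N ∧ v i ≠ 0 then l ⟨v i - 1, h.1⟩ else 0) v) := by
  intro i y hy
  funext k
  fin_cases k
  · rfl
  · rfl
  · change (if v i = 0 then 0 else ⌊y 0 0⌋₊) =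
      if h : v i - 1 < N ∧ v i ≠ 0 then l ⟨v i - 1, h.1⟩ else 0
    have hvi := hv i
    by_cases h0 : v i = 0
    · rw [if_pos h0, dif_neg (by simp [h0])]
    · have hlt : v i - 1 < N := by omega
      rw [if_neg h0, dif_pos ⟨hlt, h0⟩,
        LookupSpec.eq_of_pointer (hy 0 0) (j := ⟨v i - 1, hlt⟩)
          (show v i - 1 + 1 = v i by omega), Nat.floor_natCast]
      rfl
  · rfl

theorem table_le {S : ℕ} {u v : Fin N → ℕ} (hl : ∀ i, l i ≤ S) (hN : N ≤ S) (hu : ∀ i, u i ≤ S)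
    (hv : ∀ i, v i ≤ S) (i : Fin N) (r : Fin 4) : table l u v i r ≤ S := by
  fin_cases r
  · exact hl i
  · exact Nat.le_trans i.2 hN
  · exact hu i
  · exact hv i

theorem bounded_refineStep {B s S : ℕ} (hS : 0 < S) {R : Fin N → Registers}
    (hR : ∀ i r, R i r ≤ S) : (refineStep B s).Bounded S R := by
  have hdiv : ∀ i, (R i 1 - 1) / B ^ s / B ≤ S := fun i =>
    (Nat.div_le_self _ _).trans <| (Nat.div_le_self _ _).trans <| (Nat.sub_le _ _).trans (hR i 1)
  refine ⟨hR, fun h i => ⟨hR i 0, ?_⟩, fun h i => ⟨hR i 0, hdiv i⟩, fun h i g => ?_⟩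
  · simp only [refineStep]
    split_ifs
    · exact hdiv i
    · exact (Nat.sub_le _ _).trans (hR i 2)
  · simp only [refineStep]
    split_ifs <;> omega

theorem bounded_doubleStep {bit : Bool} {S : ℕ} {R : Fin N → Registers}
    (hR : ∀ i r, R i r ≤ S) : (doubleStep n bit).Bounded S R := by
  refine ⟨hR, fun h i => ⟨?_, Nat.zero_le _⟩, fun h i => ⟨hR i 1, Nat.zero_le _⟩,
    fun h i g => hR i 2⟩
  simp only [doubleStep]
  split_ifs
  · exact hR i 2
  · exact hR i 3

theorem bounded_fetchStep {S : ℕ} {R : Fin N → Registers}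
    (hR : ∀ i r, R i r ≤ S) : (fetchStep n).Bounded S R :=
  ⟨hR, fun _ i => ⟨hR i 3, Nat.zero_le _⟩, fun _ i => ⟨hR i 1, Nat.zero_le _⟩,
    fun _ i _ => hR i 0⟩

end TableLayer

/-! ### Induction heads -/

section inductionHop

variable {α : Type*} {N : ℕ} (w : Fin N → α)

theorem letterAt_succ (i : Fin N) : letterAt w (i + 1) = some (w i) := by
  unfold letterAt
  rw [dif_pos ⟨Nat.succ_pos _, i.2⟩]
  rfl

theorem letterAt_eq_some {j : ℕ} {x : α} (h : letterAt w j = some x) :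
    ∃ i : Fin N, (i : ℕ) + 1 = j ∧ w i = x := by
  unfold letterAt at h
  split_ifs at h with hj
  exact ⟨⟨j - 1, by omega⟩, by simp only; omega, Option.some.inj h⟩

variable [DecidableEq α]

theorem inductionHop_le (i : ℕ) : inductionHop w i ≤ i := by
  refine Finset.sup_le fun j hj => ?_
  simp only [Finset.mem_filter, Finset.mem_range] at hj
  exact Nat.lt_succ_iff.1 hj.1

/-- With blocks of length one the search gives the hop itself. The offset `2` arises because an
occurrence at 0-based index `j` has position `j + 1`, and the hop leads to the position after it;
`0` stays free for "none". -/
theorem inductionHop_succ {l : Fin N → ℕ} (hl : ∀ i j, l i = l j ↔ w i = w j) (i : Fin N) :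
    inductionHop w (i + 1) = precedingBlock l (fun j => j) i := by
  apply le_antisymm
  · refine Finset.sup_le fun j hj => ?_
    simp only [Finset.mem_filter, Finset.mem_range, letterAt_succ] at hj
    obtain ⟨hj1, -, hj2⟩ := hj
    obtain ⟨j', hj', hw⟩ := letterAt_eq_some w hj2
    have := le_precedingBlock (p := fun j : Fin N => (j : ℕ)) ((hl j' i).2 hw)
      (show (j' : ℕ) < i by omega)
    simp only [id]
    omega
  · refine Finset.sup_le fun j hj => ?_
    simp only [Finset.mem_filter, Finset.mem_univ, true_and] at hj
    refine Finset.le_sup (f := id) (b := (j : ℕ) + 2) ?_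
    simp only [Finset.mem_filter, Finset.mem_range, letterAt_succ]
    refine ⟨by omega, by simp, ?_⟩
    rw [show (j : ℕ) + 2 - 1 = j + 1 from rfl, letterAt_succ, (hl j i).1 hj.1]

end inductionHop

/-! ### The program for `k` hops -/

namespace TableProgram

open TableLayer

variable {N : ℕ}

/-- The program for `k` hops: it finds the preceding occurrence of the letter of each row by refining
blocks of `n + 1` pieces `D` times, then composes hops along the binary expansion of `k`. -/
def hopProgram (n D k : ℕ) : TableProgram (n + 1) := fun t =>
  if t < D then refineStep (n + 1) (D - 1 - t)
  else if t < D + k.size then doubleStep n (k.testBit (t - D))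
  else fetchStep n

/-- The registers during the run of `hopProgram` for the hop function `f`. -/
def hopTable (n D k : ℕ) (l : Fin N → ℕ) (f : ℕ → ℕ) (t : ℕ) : Fin N → Registers :=
  if t < D then
    table l (precedingBlock l fun j => (j : ℕ) / (n + 1) ^ (D - t)) fun j => j + 1
  else if t ≤ D + k.size then
    table l (fun j => f^[2 ^ (t - D)] (j + 1)) fun j => f^[k % 2 ^ (t - D)] (j + 1)
  else table l (fun i => if h : f^[k] (i + 1) - 1 < N ∧ f^[k] (i + 1) ≠ 0 then
    l ⟨f^[k] (i + 1) - 1, h.1⟩ else 0) fun i => f^[k] (i + 1)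

variable {n D k : ℕ} {l : Fin N → ℕ} {f : ℕ → ℕ}

/-- The two phases agree at `t = D`: blocks of length one give `f^[2 ^ 0]`, and register `3`, the
position itself, is `f^[k % 2 ^ 0]`. -/
theorem hopTable_of_le (hf : ∀ i : Fin N, f (i + 1) = precedingBlock l (fun j => j) i) {t : ℕ}
    (ht : t ≤ D) : hopTable n D k l f t =
      table l (precedingBlock l fun j => (j : ℕ) / (n + 1) ^ (D - t)) fun j => j + 1 := by
  unfold hopTable
  split_ifs with h1 h2
  · rfl
  · obtain rfl : t = D := by omega
    simp only [Nat.sub_self, pow_zero, Nat.mod_one, Function.iterate_one, Function.iterate_zero, id,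
      hf, Nat.div_one]
  · omega

theorem computes_hopProgram (hf : ∀ i : Fin N, f (i + 1) = precedingBlock l (fun j => j) i)
    (hf' : ∀ x, f x ≤ x) {t : ℕ} (ht : t < D + k.size + 1) :
    (hopProgram n D k t).Computes (hopTable n D k l f t) (hopTable n D k l f (t + 1)) := by
  rcases lt_or_ge t D with h1 | h1
  · rw [hopTable_of_le hf h1.le, hopTable_of_le hf h1]
    simp only [hopProgram, if_pos h1]
    have h2 := computes_refineStep (l := l) (Nat.succ_pos n) (D - 1 - t)
    rw [show D - 1 - t + 1 = D - t by omega] at h2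
    rw [show D - (t + 1) = D - 1 - t by omega]
    exact h2
  obtain ⟨τ, rfl⟩ := Nat.exists_eq_add_of_le h1
  have htab : hopTable n D k l f (D + τ) =
      table l (fun j => f^[2 ^ τ] (j + 1)) fun j => f^[k % 2 ^ τ] (j + 1) := by
    unfold hopTable
    rw [if_neg (by omega), if_pos (by omega), Nat.add_sub_cancel_left]
  rw [htab]
  rcases lt_or_ge τ k.size with h2 | h2
  · have htab' : hopTable n D k l f (D + τ + 1) =
        table l (fun j => f^[2 ^ (τ + 1)] (j + 1)) fun j => f^[k % 2 ^ (τ + 1)] (j + 1) := by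
      unfold hopTable
      rw [if_neg (by omega), if_pos (by omega), add_assoc, Nat.add_sub_cancel_left]
    have hP : hopProgram n D k (D + τ) = doubleStep n (k.testBit τ) := by
      unfold hopProgram
      rw [if_neg (by omega), if_pos (by omega), Nat.add_sub_cancel_left]
    rw [htab', hP]
    have h3 := computes_doubleStep (n := n) (l := l) hf' (k.testBit τ) (2 ^ τ) (k % 2 ^ τ)
    -- Bit `τ` of `k` decides whether the next residue of `k` gains `2 ^ τ`.
    have h4 : (if k.testBit τ then 2 ^ τ + k % 2 ^ τ else k % 2 ^ τ) = k % 2 ^ (τ + 1) := by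
      rw [Nat.mod_pow_succ, ← Nat.toNat_testBit]
      cases k.testBit τ <;> simp [add_comm]
    rwa [h4, ← two_mul, ← pow_succ'] at h3
  · obtain rfl : τ = k.size := by omega
    have hk : k % 2 ^ k.size = k := Nat.mod_eq_of_lt (Nat.lt_size_self k)
    have htab' : hopTable n D k l f (D + k.size + 1) =
        table l (fun i => if h : f^[k] (i + 1) - 1 < N ∧ f^[k] (i + 1) ≠ 0 then
          l ⟨f^[k] (i + 1) - 1, h.1⟩ else 0) fun i => f^[k] (i + 1) := by
      unfold hopTable
      rw [if_neg (by omega), if_neg (by omega)]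
    have hP : hopProgram n D k (D + k.size) = fetchStep n := by
      unfold hopProgram
      rw [if_neg (by omega), if_neg (by omega)]
    rw [htab', hP, hk]
    exact computes_fetchStep fun i => (iterate_le hf' _ _).trans i.2

theorem bounded_hopProgram (hf' : ∀ x, f x ≤ x) {S : ℕ} (hN : N + 1 ≤ S) (hl : ∀ i, l i ≤ S)
    (t : ℕ) : (hopProgram n D k t).Bounded S (hopTable n D k l f t) := by
  have hit : ∀ a (i : Fin N), f^[a] (i + 1) ≤ S := fun a i =>
    (iterate_le hf' _ _).trans (by omega)
  have hR : ∀ i r, hopTable n D k l f t i r ≤ S := by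
    unfold hopTable
    split_ifs
    · refine table_le hl (by omega) (fun i => (precedingBlock_le i).trans ?_) fun i => by omega
      exact (Nat.succ_le_succ (Nat.div_le_self _ _)).trans (by omega)
    · exact table_le hl (by omega) (hit _) (hit _)
    · refine table_le hl (by omega) (fun i => ?_) (hit _)
      split_ifs
      · exact hl _
      · exact Nat.zero_le _
  unfold hopProgram
  split_ifs
  · exact bounded_refineStep (by omega) hR
  · exact bounded_doubleStep hR
  · exact bounded_fetchStep hR

/-- The code of the symbol at position `p`, as a natural number. -/
theorem letterCode_letterAt {α : Type*} [Fintype α] (e : α ≃ Fin (Fintype.card α))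
    (w : Fin N → α) {p : ℕ} (hp : p ≤ N) :
    letterCode e (letterAt w p) = ((if h : p - 1 < N ∧ p ≠ 0 then
      (e (w ⟨p - 1, h.1⟩) : ℕ) + 1 else 0 : ℕ) : ℝ) := by
  by_cases h0 : p = 0
  · subst h0
    simp [letterAt, letterCode]
  · rw [dif_pos ⟨by omega, h0⟩, letterAt, dif_pos ⟨by omega, hp⟩]
    simp [letterCode]

theorem output_hopProgram {α : Type*} [Fintype α] [DecidableEq α]
    (e : α ≃ Fin (Fintype.card α)) (w : Fin N → α) {S a : ℕ} (hS : (N + 1) ^ (a + 1) ≤ S)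
    (hcard : Fintype.card α ≤ S) (hD : N ≤ (n + 1) ^ D)
    {r c ell : ℝ} (hr : 0 ≤ r) (hc : 1 ≤ c) (hcr : c * r < 1)
    (hell : 1 ≤ ell) (hella : ell ≤ ((N : ℝ) + 1) ^ a) {Ω : Type}
    {A : Fin (D + k.size + 1) → Fin 3 → Ω → (Fin N → Fin (4 + 2 * (n + 1)) → ℝ) →
      Fin N → Fin N → ℝ}
    (h0 : ∀ t h ω X i j, 0 ≤ A t h ω X i j) (h1 : ∀ t h ω X i, ∑ j, A t h ω X i j = 1)
    {seed : Fin (D + k.size + 1) → Ω}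
    (hgood : ∀ t h, ((hopProgram n D k).toTransformer (D + k.size + 1) S).HeadGood S r c ell A
      (wordInput e _ w) t h seed) (i : Fin N) :
    ((hopProgram n D k).toTransformer (D + k.size + 1) S).output S A seed (wordInput e _ w) i =
      kHopOutput e _ k w i := by
  set l : Fin N → ℕ := fun j => (e (w j) : ℕ) + 1 with hl
  have hinj : ∀ i j, l i = l j ↔ w i = w j := by
    intro i j
    simp only [hl, Nat.add_right_cancel_iff, Fin.val_inj, EmbeddingLike.apply_eq_iff_eq]
  have hlS : ∀ i, l i ≤ S := fun j => Nat.le_trans (e (w j)).2 hcard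
  have hNS : N + 1 ≤ S := (Nat.le_self_pow (Nat.succ_ne_zero a) _).trans hS
  have hf := inductionHop_succ w hinj
  have hf' := inductionHop_le w
  have hX : ∀ i, (hopProgram n D k).decode 0 (wordInput e _ w i) =
      hopTable n D k l (inductionHop w) 0 i := by
    intro i
    -- Since `N ≤ (n + 1) ^ D`, all rows start in one coarse block, so no block precedes it and
    -- register `2` rightly starts at `0`.
    have hzero : precedingBlock l (fun j : Fin N => (j : ℕ) / (n + 1) ^ D) i = 0 := by
      by_contra hcon
      obtain ⟨j, -, hlt, -⟩ := exists_eq_precedingBlock hcon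
      rw [Nat.div_eq_of_lt (i.2.trans_le hD)] at hlt
      exact Nat.not_lt_zero _ hlt
    have h10 : ((1 : Fin (4 + 2 * (n + 1))) : ℕ) = 1 := by
      rw [Fin.val_one']
      exact Nat.mod_eq_of_lt (by omega)
    have hx0 : ⌊wordInput e (4 + 2 * (n + 1)) w i 0⌋₊ = l i := by
      simp only [wordInput, Fin.val_zero, if_true, letterCode, hl]
      exact_mod_cast Nat.floor_natCast ((e (w i) : ℕ) + 1)
    have hx1 : ⌊wordInput e (4 + 2 * (n + 1)) w i 1⌋₊ = i + 1 := by
      simp only [wordInput, h10, one_ne_zero, if_false, if_true]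
      exact_mod_cast Nat.floor_natCast ((i : ℕ) + 1)
    rw [hopTable_of_le hf (Nat.zero_le D)]
    simp only [decode, hx0, hx1, table, Nat.sub_zero, hzero]
  have hpos : ∀ t i, hopTable n D k l (inductionHop w) t i 1 = (i : ℕ) + 1 := by
    intro t i
    unfold hopTable
    split_ifs <;> rfl
  have hfinal := (hopProgram n D k).decode_state hS hpos
    (fun t _ => bounded_hopProgram hf' hNS hlS t) (fun t ht => computes_hopProgram hf hf' ht)
    hr hc hcr hell hella h0 h1 hgood hX _ le_rfl i
  funext b
  have hb : b = 0 ↔ (b : ℕ) = 0 := Fin.ext_iff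
  unfold Transformer.output
  have htab : hopTable n D k l (inductionHop w) (D + k.size + 1) i 2 =
      if h : (inductionHop w)^[k] (i + 1) - 1 < N ∧ (inductionHop w)^[k] (i + 1) ≠ 0 then
        l ⟨(inductionHop w)^[k] (i + 1) - 1, h.1⟩ else 0 := by
    unfold hopTable
    rw [if_neg (by omega), if_neg (by omega)]
    rfl
  change ((if b = 0 then min ((hopProgram n D k).decode _ _ 2) S else 0 : ℕ) : ℝ) = _
  rw [hfinal, htab]
  simp only [hb, kHopOutput]
  by_cases hb0 : (b : ℕ) = 0
  · rw [if_pos hb0, if_pos hb0, kHop,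
      letterCode_letterAt e w ((iterate_le hf' _ _).trans i.2)]
    congr 1
    refine min_eq_left ?_
    split_ifs
    · exact hlS _
    · exact Nat.zero_le _
  · rw [if_neg hb0, if_neg hb0, Nat.cast_zero]

end TableProgram

/-! ### Size estimates and conclusion -/

theorem natSize_le_mul_log (k : ℕ) : (k.size : ℝ) ≤ 4 * Real.log ((k : ℝ) + 2) := by
  have hlog2 := Real.log_two_gt_d9
  have h2 : Real.log 2 ≤ Real.log ((k : ℝ) + 2) :=
    Real.log_le_log (by norm_num) (by linarith [(Nat.cast_nonneg k : (0 : ℝ) ≤ k)])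
  rcases Nat.eq_zero_or_pos k.size with h0 | h0
  · rw [h0, Nat.cast_zero]
    linarith
  · have h3 : 2 ^ (k.size - 1) ≤ k := Nat.lt_size.1 (by omega)
    have h4 : (2 : ℝ) ^ (k.size - 1) ≤ (k : ℝ) + 2 := by
      have : (2 : ℝ) ^ (k.size - 1) ≤ k := by exact_mod_cast h3
      linarith
    have h5 := Real.log_le_log (by positivity) h4
    rw [Real.log_pow, Nat.cast_sub h0, Nat.cast_one] at h5
    nlinarith [(Nat.one_le_cast (α := ℝ)).2 h0]

/-- This bounds the depth of the search: a tree of branching at least `N ^ x` has at least `N`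
leaves at depth `⌈1 / x⌉`. -/
theorem le_ceil_rpow_pow (N : ℕ) (hN : 1 ≤ N) {x : ℝ} (hx : 0 < x) :
    N ≤ (⌈(N : ℝ) ^ x⌉₊ + 1) ^ ⌈1 / x⌉₊ := by
  have hN' : (1 : ℝ) ≤ N := by exact_mod_cast hN
  have h1 : (1 : ℝ) ≤ (N : ℝ) ^ x := Real.one_le_rpow hN' hx.le
  have : (N : ℝ) ≤ ((⌈(N : ℝ) ^ x⌉₊ : ℝ) + 1) ^ ⌈1 / x⌉₊ := by
    calc (N : ℝ) = ((N : ℝ) ^ x) ^ (1 / x) := by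
          rw [← Real.rpow_mul (by linarith), mul_one_div_cancel hx.ne', Real.rpow_one]
      _ ≤ ((N : ℝ) ^ x) ^ (⌈1 / x⌉₊ : ℝ) := Real.rpow_le_rpow_of_exponent_le h1 (Nat.le_ceil _)
      _ = ((N : ℝ) ^ x) ^ ⌈1 / x⌉₊ := Real.rpow_natCast _ _
      _ ≤ _ := by
        refine pow_le_pow_left₀ (by linarith) ?_ _
        linarith [Nat.le_ceil ((N : ℝ) ^ x)]
  exact_mod_cast this

end

theorem theorem5p3 (ε ε' : ℝ) (hε : 0 < ε) (hεε' : ε < ε') (hε' : ε' < 1) (C₀ : ℝ) :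
    ∃ C : ℝ, 0 < C ∧ ∀ a : ℕ, ∃ ζ : ℕ, ∀ N : ℕ, 1 ≤ N → ∀ k : ℕ,
      ∀ (α : Type*) [Fintype α] [DecidableEq α], (Fintype.card α : ℝ) ≤ C₀ * N →
      ∀ e : α ≃ Fin (Fintype.card α),
      ∃ (L H m d : ℕ) (T : Transformer L H m d),
        (L : ℝ) ≤ C * Real.log ((k : ℝ) + 2) ∧
        (H : ℝ) ≤ C * (N : ℝ) ^ ((ε' - ε) / 4) ∧
        (m : ℝ) ≤ C * (N : ℝ) ^ ε' ∧
        (d : ℝ) ≤ C * (N : ℝ) ^ ε' ∧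
        T.HasPrecision ((N + 1) ^ ζ) ∧
        ∀ c : ℝ, 1 ≤ c → ∃ r : ℝ, 0 < r ∧
          ∀ ell : ℝ, 1 ≤ ell → ell ≤ ((N : ℝ) + 1) ^ a → ∀ η : ℝ, 0 ≤ η →
          ∀ (Ω : Type) [MeasurableSpace Ω] (μ : Measure Ω) [IsProbabilityMeasure μ]
            (A : Fin L → Fin H → Ω → (Fin N → Fin d → ℝ) → Fin N → Fin N → ℝ),
            (∀ t h, IsANNA (T.Q t h) (T.K t h) r c ell η μ (A t h)) →
            ∀ w : Fin N → α,
              1 - L * H * η ≤ (Measure.pi fun _ : Fin L => μ).real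
                {seed | ∀ i, T.output ((N + 1) ^ ζ) A seed (wordInput e d w) i =
                  kHopOutput e d k w i} := by
  have hpos : 0 < ε' := hε.trans hεε'
  set D := ⌈1 / ε'⌉₊ with hD
  -- As `C₀ < 2 ^ z` and `2 ≤ N + 1`, every letter code is at most `(N + 1) ^ (z + 1)`.
  obtain ⟨z, hz⟩ := pow_unbounded_of_one_lt C₀ one_lt_two
  -- The part `2 * D` absorbs the search layers, as `log 2 > 1 / 2`; `16` amply covers the digits of
  -- `k`, the three heads and the dimension. In the precision, `a + 1` serves the smallest weight
  -- and `z + 1` the alphabet.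
  refine ⟨2 * D + 16, by positivity, fun a => ⟨a + 1 + (z + 1), fun N hN k α _ _ hcard e => ?_⟩⟩
  have hN' : (1 : ℝ) ≤ N := by exact_mod_cast hN
  set n := ⌈(N : ℝ) ^ ε'⌉₊ with hn
  set S := (N + 1) ^ (a + 1 + (z + 1)) with hS
  have hS0 : 0 < S := by positivity
  have hSa : (N + 1) ^ (a + 1) ≤ S := Nat.pow_le_pow_right (Nat.succ_pos N) (Nat.le_add_right _ _)
  have hSc : Fintype.card α ≤ S := by
    have h1 : (Fintype.card α : ℝ) ≤ ((N : ℝ) + 1) ^ (z + 1) := by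
      calc (Fintype.card α : ℝ) ≤ C₀ * N := hcard
        _ ≤ 2 ^ z * N := by gcongr
        _ ≤ ((N : ℝ) + 1) ^ z * (N + 1) := by gcongr <;> linarith
        _ = _ := (pow_succ _ _).symm
    have h2 : Fintype.card α ≤ (N + 1) ^ (z + 1) := by exact_mod_cast h1
    exact h2.trans (Nat.pow_le_pow_right (Nat.succ_pos N) (Nat.le_add_left _ _))
  have hNe : (1 : ℝ) ≤ (N : ℝ) ^ ε' := Real.one_le_rpow hN' hpos.le
  have hNH : (1 : ℝ) ≤ (N : ℝ) ^ ((ε' - ε) / 4) := Real.one_le_rpow hN' (by linarith)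
  have hD0 : (0 : ℝ) ≤ D := Nat.cast_nonneg D
  have hdim : ((4 + 2 * (n + 1) : ℕ) : ℝ) ≤ (2 * D + 16) * (N : ℝ) ^ ε' := by
    have := (Nat.ceil_lt_add_one (show (0 : ℝ) ≤ (N : ℝ) ^ ε' by linarith)).le
    rw [← hn] at this
    push_cast
    nlinarith
  -- The radius `1 / (2 * c)` makes `c * r = 1 / 2`, below the distance `1` between distinct integer
  -- vectors.
  refine ⟨D + k.size + 1, 3, 4 + 2 * (n + 1), 4 + 2 * (n + 1),
    (TableProgram.hopProgram n D k).toTransformer _ S, ?_, ?_, hdim, hdim,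
    TableProgram.hasPrecision_toTransformer _ _ hS0, fun c hc => ⟨1 / (2 * c), by positivity, ?_⟩⟩
  · have h1 := natSize_le_mul_log k
    have h2 : Real.log 2 ≤ Real.log ((k : ℝ) + 2) :=
      Real.log_le_log (by norm_num) (by linarith [(Nat.cast_nonneg k : (0 : ℝ) ≤ k)])
    have h3 := Real.log_two_gt_d9
    push_cast
    nlinarith
  · push_cast
    nlinarith
  · intro ell hell hella η hη Ω _ μ _ A hA w
    have hcr : c * (1 / (2 * c)) < 1 := by
      have : c ≠ 0 := by positivity
      field_simp
      norm_num
    refine (Transformer.le_measureReal_headGood _ S hη hA (wordInput e _ w)).trans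
      (measureReal_mono fun seed hseed i => ?_)
    exact TableProgram.output_hopProgram e w hSa hSc (le_ceil_rpow_pow N hN hpos) (by positivity)
      hc hcr hell hella (fun t h => (hA t h).nonneg) (fun t h => (hA t h).sum_eq_one) hseed i
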